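/- Let $(X,d)$ be a metric space with a base point $e\in X$. Let $\mathrm{Lip}_0(X)$ be the Banach space of all real-valued Lipschitz functions $f$ on $X$ with $f(e)=0$, normed by the least Lipschitz constant $L(f)$ of $f$. For $x\in X$ let $j(x)\in\mathrm{Lip}_0(X)^*$ be the evaluation $f\mapsto f(x)$, and let $\mathcal F(X)=\overline{\mathrm{span}}\,j(X)\subset\mathrm{Lip}_0(X)^*$ be the Lipschitz-free space over $X$. For distinct $p,q\in X$ put $u_{pq}=\dfrac{j(p)-j(q)}{d(p,q)}\in\mathcal F(X)$. Let $\widetilde X=\{(x,y)\in X\times X: x\neq y\}$ with the subspace topology, let $\beta\widetilde X$ be its Stone–Čech compactification (with $\widetilde X$ regarded as a subset of it), and for $f\in\mathrm{Lip}_0(X)$ let $\Phi f(x,y)=\dfrac{f(x)-f(y)}{d(x,y)}$ for $(x,y)\in\widetilde X$; this bounded continuous function is extended continuously to $\beta\widetilde X$, and the extension is again denoted by $\Phi f$. Proposition 3.4. Let $(p,q)\in\widetilde X$ be such that for every $\zeta\in\beta\widetilde X\setminus\{(p,q),(q,p)\}$ there is $f\in\mathrm{Lip}_0(X)$ with $\Phi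 f(p,q)=L(f)$ and $|\Phi f(\zeta)|<L(f)$. Then $u_{pq}$ is a preserved extreme point of the closed unit ball $B_{\mathcal F(X)}$, that is, $u_{pq}$ is an extreme point of $B_{\mathcal F(X)}$ and its canonical image in $\mathcal F(X)^{**}$ is an extreme point of $B_{\mathcal F(X)^{**}}$. -/

import Mathlib

noncomputable section

namespace LipschitzFree

open Set

/-- `C` is a (nonnegative) Lipschitz constant of `f`. -/
def IsLipConst {X : Type*} [MetricSpace X] (f : X → ℝ) (C : ℝ) : Prop :=
  0 ≤ C ∧ ∀ x y, |f x - f y| ≤ C * dist x y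

/-- `L(f)`, the tightest Lipschitz constant of a Lipschitz function `f`. -/
def lipNum {X : Type*} [MetricSpace X] (f : X → ℝ) : ℝ :=
  sInf {C | IsLipConst f C}

theorem bddBelow_isLipConst {X : Type*} [MetricSpace X] (f : X → ℝ) :
    BddBelow {C | IsLipConst f C} :=
  ⟨0, fun _ hC => hC.1⟩

theorem lipNum_nonneg {X : Type*} [MetricSpace X] (f : X → ℝ) : 0 ≤ lipNum f :=
  Real.sInf_nonneg fun _ hC => hC.1

theorem lipNum_le {X : Type*} [MetricSpace X] {f : X → ℝ} {C : ℝ} (h : IsLipConst f C) :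
    lipNum f ≤ C :=
  csInf_le (bddBelow_isLipConst f) h

/-- The infimum defining `L(f)` is attained when `f` is Lipschitz. -/
theorem isLipConst_lipNum {X : Type*} [MetricSpace X] {f : X → ℝ} (h : ∃ C, IsLipConst f C) :
    IsLipConst f (lipNum f) := by
  refine ⟨lipNum_nonneg f, fun x y => ?_⟩
  rcases eq_or_ne x y with rfl | hxy
  · simp
  · have hd : 0 < dist x y := dist_pos.2 hxy
    rw [← div_le_iff₀ hd]
    refine le_csInf h fun C hC => ?_
    rw [div_le_iff₀ hd]
    exact hC.2 x y

theorem IsLipConst.add {X : Type*} [MetricSpace X] {f g : X → ℝ} {C D : ℝ}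
    (hf : IsLipConst f C) (hg : IsLipConst g D) : IsLipConst (f + g) (C + D) := by
  refine ⟨add_nonneg hf.1 hg.1, fun x y => ?_⟩
  have h : (f + g) x - (f + g) y = (f x - f y) + (g x - g y) := by
    simp only [Pi.add_apply]; ring
  rw [h, add_mul]
  exact (abs_add_le _ _).trans (add_le_add (hf.2 x y) (hg.2 x y))

theorem IsLipConst.smul {X : Type*} [MetricSpace X] {f : X → ℝ} {C : ℝ}
    (hf : IsLipConst f C) (c : ℝ) : IsLipConst (c • f) (|c| * C) := by
  refine ⟨mul_nonneg (abs_nonneg c) hf.1, fun x y => ?_⟩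
  have h : (c • f) x - (c • f) y = c * (f x - f y) := by
    simp only [Pi.smul_apply, smul_eq_mul]; ring
  rw [h, abs_mul, mul_assoc]
  exact mul_le_mul_of_nonneg_left (hf.2 x y) (abs_nonneg c)

/-- The linear space of real Lipschitz functions on `X` that vanish at the base point `e`. -/
def lip0Submodule (X : Type*) [MetricSpace X] (e : X) : Submodule ℝ (X → ℝ) where
  carrier := {f | (∃ C, IsLipConst f C) ∧ f e = 0}
  add_mem' := by
    rintro f g ⟨⟨C, hC⟩, hf⟩ ⟨⟨D, hD⟩, hg⟩
    exact ⟨⟨C + D, hC.add hD⟩, by simp [hf, hg]⟩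
  zero_mem' := ⟨⟨0, le_rfl, fun x y => by simp⟩, rfl⟩
  smul_mem' := by
    rintro c f ⟨⟨C, hC⟩, hf⟩
    exact ⟨⟨|c| * C, hC.smul c⟩, by simp [hf]⟩

/-- `Lip₀(X)`, for the metric space `X` pointed at `e`. It is a type of its own, so that its only
topology is the one of the norm `L`. -/
def Lip0 (X : Type*) [MetricSpace X] (e : X) : Type _ := lip0Submodule X e

instance (X : Type*) [MetricSpace X] (e : X) : AddCommGroup (Lip0 X e) :=
  inferInstanceAs (AddCommGroup (lip0Submodule X e))

instance (X : Type*) [MetricSpace X] (e : X) : Module ℝ (Lip0 X e) :=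
  inferInstanceAs (Module ℝ (lip0Submodule X e))

/-- The underlying function of an element of `Lip₀(X)`. -/
def Lip0.toFun {X : Type*} [MetricSpace X] {e : X} (f : Lip0 X e) : X → ℝ := f.1

instance (X : Type*) [MetricSpace X] (e : X) : CoeFun (Lip0 X e) (fun _ => X → ℝ) :=
  ⟨Lip0.toFun⟩

/-- `Lip₀(X)` carries the norm `L`. -/
instance (X : Type*) [MetricSpace X] (e : X) : Norm (Lip0 X e) := ⟨fun f => lipNum f⟩

theorem Lip0.isLipConst_norm {X : Type*} [MetricSpace X] {e : X} (f : Lip0 X e) :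
    IsLipConst f ‖f‖ :=
  isLipConst_lipNum f.2.1

theorem Lip0.core (X : Type*) [MetricSpace X] (e : X) : NormedSpace.Core ℝ (Lip0 X e) where
  norm_nonneg f := lipNum_nonneg _
  norm_smul c f := by
    have key : ∀ (c : ℝ) (f : Lip0 X e), ‖c • f‖ ≤ |c| * ‖f‖ := fun c f =>
      lipNum_le ((Lip0.isLipConst_norm f).smul c)
    refine le_antisymm (key c f) ?_
    rcases eq_or_ne c 0 with rfl | hc
    · rw [norm_zero, zero_mul]
      exact lipNum_nonneg _
    · have h := key c⁻¹ (c • f)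
      rw [smul_smul, inv_mul_cancel₀ hc, one_smul, abs_inv,
        inv_mul_eq_div, le_div_iff₀ (abs_pos.2 hc)] at h
      rw [Real.norm_eq_abs, mul_comm]
      exact h
  norm_triangle f g := lipNum_le ((Lip0.isLipConst_norm f).add (Lip0.isLipConst_norm g))
  norm_eq_zero_iff f := by
    constructor
    · intro h
      have hf := (Lip0.isLipConst_norm f).2
      rw [h] at hf
      refine Subtype.ext (funext fun x => ?_)
      have hx := hf x e
      rw [zero_mul] at hx
      have h0 : f x - f e = 0 := abs_nonpos_iff.1 hx
      have he : f e = 0 := f.2.2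
      rw [he, sub_zero] at h0
      exact h0
    · rintro rfl
      refine le_antisymm (lipNum_le ⟨le_rfl, fun x y => ?_⟩) (lipNum_nonneg _)
      change |(0 : ℝ) - 0| ≤ 0 * dist x y
      simp

instance (X : Type*) [MetricSpace X] (e : X) : NormedAddCommGroup (Lip0 X e) :=
  NormedAddCommGroup.ofCore (Lip0.core X e)

instance (X : Type*) [MetricSpace X] (e : X) : NormedSpace ℝ (Lip0 X e) :=
  NormedSpace.ofCore (Lip0.core X e)

/-- The evaluation functional `f ↦ f x` on `Lip₀(X)`. -/
def evalDual {X : Type*} [MetricSpace X] (e : X) (x : X) : StrongDual ℝ (Lip0 X e) :=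
  LinearMap.mkContinuous
    { toFun := fun f => f x
      map_add' := fun _ _ => rfl
      map_smul' := fun _ _ => rfl }
    (dist x e) (fun f => by
      have h := (Lip0.isLipConst_norm f).2 x e
      have he : f e = 0 := f.2.2
      rw [he, sub_zero, mul_comm] at h
      exact h)

/-- The Lipschitz-free space over `X`: the norm-closed linear span of the evaluation functionals
in the dual of `Lip₀(X)`, with the dual norm. -/
abbrev LipFree (X : Type*) [MetricSpace X] (e : X) : Submodule ℝ (StrongDual ℝ (Lip0 X e)) :=
  (Submodule.span ℝ (range (evalDual e))).topologicalClosure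

/-- The canonical embedding `j` of `X` into its Lipschitz-free space. -/
def j {X : Type*} [MetricSpace X] (e : X) (x : X) : LipFree X e :=
  ⟨evalDual e x, Submodule.le_topologicalClosure _ (Submodule.subset_span (mem_range_self x))⟩

/-- The elementary molecule `u_{pq} = (j(p) - j(q)) / d(p,q)` (of interest for `p ≠ q`). -/
def molecule {X : Type*} [MetricSpace X] (e p q : X) : LipFree X e :=
  (dist p q)⁻¹ • (j e p - j e q)

/-- `x` is a preserved extreme point of the closed unit ball of the normed space `Y`: it is an
extreme point of the ball of `Y`, and its canonical image in the bidual is an extreme point of the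
ball of the bidual. -/
def IsPreservedExtremePoint {Y : Type*} [NormedAddCommGroup Y] [NormedSpace ℝ Y] (x : Y) : Prop :=
  x ∈ extremePoints ℝ (Metric.closedBall (0 : Y) 1) ∧
    NormedSpace.inclusionInDoubleDual ℝ Y x ∈
      extremePoints ℝ (Metric.closedBall (0 : StrongDual ℝ (StrongDual ℝ Y)) 1)

/-- The space of pairs of distinct points of `X`, with the subspace topology of `X × X`. -/
abbrev OffDiag (X : Type*) [MetricSpace X] : Type _ := {z : X × X // z.1 ≠ z.2}

/-- `Φ f (x, y) = (f x - f y) / d(x, y)` on pairs of distinct points. -/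
def Phi {X : Type*} [MetricSpace X] {e : X} (f : Lip0 X e) (z : OffDiag X) : ℝ :=
  (f z.1.1 - f z.1.2) / dist z.1.1 z.1.2

theorem abs_Phi_le {X : Type*} [MetricSpace X] {e : X} (f : Lip0 X e) (z : OffDiag X) :
    |Phi f z| ≤ ‖f‖ := by
  have hd : 0 < dist z.1.1 z.1.2 := dist_pos.2 z.2
  rw [Phi, abs_div, abs_of_pos hd, div_le_iff₀ hd]
  exact (Lip0.isLipConst_norm f).2 _ _

theorem Lip0.continuous {X : Type*} [MetricSpace X] {e : X} (f : Lip0 X e) :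
    Continuous (f : X → ℝ) := by
  have h : LipschitzWith ⟨‖f‖, norm_nonneg f⟩ (f : X → ℝ) :=
    LipschitzWith.of_dist_le_mul fun x y => (Lip0.isLipConst_norm f).2 x y
  exact h.continuous

theorem continuous_Phi {X : Type*} [MetricSpace X] {e : X} (f : Lip0 X e) :
    Continuous (Phi f) := by
  have h1 : Continuous fun z : OffDiag X => z.1.1 := continuous_fst.comp continuous_subtype_val
  have h2 : Continuous fun z : OffDiag X => z.1.2 := continuous_snd.comp continuous_subtype_val
  exact ((f.continuous.comp h1).sub (f.continuous.comp h2)).div (h1.dist h2)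
    fun z => (dist_pos.2 z.2).ne'

/-- `Φ f` as a map into the compact interval `[-L(f), L(f)]`. -/
def PhiIcc {X : Type*} [MetricSpace X] {e : X} (f : Lip0 X e) (z : OffDiag X) :
    Icc (-‖f‖) ‖f‖ :=
  ⟨Phi f z, abs_le.1 (abs_Phi_le f z)⟩

theorem continuous_PhiIcc {X : Type*} [MetricSpace X] {e : X} (f : Lip0 X e) :
    Continuous (PhiIcc f) :=
  (continuous_Phi f).subtype_mk _

/-- The continuous extension of `Φ f` to the Stone–Čech compactification of the space of pairs of
distinct points. -/
def PhiBeta {X : Type*} [MetricSpace X] {e : X} (f : Lip0 X e) (ζ : StoneCech (OffDiag X)) : ℝ :=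
  (stoneCechExtend (continuous_PhiIcc f) ζ : Icc (-‖f‖) ‖f‖)

/-- The point `(p, q)` of the Stone–Čech compactification, for `p ≠ q`. -/
def pairPt {X : Type*} [MetricSpace X] {p q : X} (h : p ≠ q) : StoneCech (OffDiag X) :=
  stoneCechUnit ⟨(p, q), h⟩

end LipschitzFree

end

namespace LipschitzFree

open Set Topology

section

variable {X : Type*} [MetricSpace X] {e : X}

/-! Since every functional on the free space comes from `Lip0 X e`, an element of the bidual ball is
determined by the functional `M` it induces there, with `|M f| ≤ ‖f‖`. If the molecule is a proper
convex combination of two such elements, each must take the value `‖f‖` at every `f` peaking at `(p,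
q)`. This already forces `M` to be evaluation of `Phi` at `(p, q)` (`apply_eq_Phi_of_peaking`),
whence extremality. To see this, let `Phi f` vanish at `(p, q)`. The compact set where `|PhiBeta f|
≥ ε` avoids `(p, q)` and `(q, p)`, so some `F` peaking at `(p, q)` stays uniformly below its norm
there (`exists_peak_of_isCompact`). For small `t > 0`, adding `t • f` to `F` raises the norm by at
most `t * ε`, so `M f ≤ ε`. -/

theorem PhiBeta_stoneCechUnit (f : Lip0 X e) (z : OffDiag X) :
    PhiBeta f (stoneCechUnit z) = Phi f z := by
  rw [PhiBeta, stoneCechExtend_stoneCechUnit]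
  rfl

theorem continuous_PhiBeta (f : Lip0 X e) : Continuous (PhiBeta f) :=
  continuous_subtype_val.comp (continuous_stoneCechExtend (continuous_PhiIcc f))

theorem Phi_add (f g : Lip0 X e) (z : OffDiag X) : Phi (f + g) z = Phi f z + Phi g z := by
  have h : ∀ x, (f + g : Lip0 X e) x = f x + g x := fun _ => rfl
  simp only [Phi, h]
  ring

theorem Phi_smul (c : ℝ) (f : Lip0 X e) (z : OffDiag X) : Phi (c • f) z = c * Phi f z := by
  have h : ∀ x, (c • f : Lip0 X e) x = c * f x := fun _ => rfl
  simp only [Phi, h]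
  ring

theorem Phi_swap (f : Lip0 X e) {p q : X} (h : p ≠ q) :
    Phi f ⟨(q, p), h.symm⟩ = -Phi f ⟨(p, q), h⟩ := by
  simp only [Phi, dist_comm q p]
  ring

theorem norm_le_of_abs_Phi_le (f : Lip0 X e) {C : ℝ} (hC : 0 ≤ C)
    (h : ∀ z, |Phi f z| ≤ C) : ‖f‖ ≤ C := by
  refine lipNum_le ⟨hC, fun x y => ?_⟩
  rcases eq_or_ne x y with rfl | hxy
  · simp
  · have hd : 0 < dist x y := dist_pos.2 hxy
    have := h ⟨(x, y), hxy⟩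
    rwa [Phi, abs_div, abs_of_pos hd, div_le_iff₀ hd] at this

/-- The distance to `q`, normalised to vanish at the base point. -/
def distLip0 (e q : X) : Lip0 X e :=
  ⟨fun x => dist x q - dist e q, ⟨1, zero_le_one, fun x y => by
    have := abs_dist_sub_le x y q
    simpa using this⟩, sub_self _⟩

theorem Phi_distLip0 (e : X) {p q : X} (h : p ≠ q) : Phi (distLip0 e q) ⟨(p, q), h⟩ = 1 := by
  have hd : dist p q ≠ 0 := dist_ne_zero.2 h
  change ((dist p q - dist e q) - (dist q q - dist e q)) / dist p q = 1
  rw [dist_self]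
  field_simp
  ring

theorem norm_distLip0_le (e q : X) : ‖distLip0 e q‖ ≤ 1 := by
  refine lipNum_le ⟨zero_le_one, fun x y => ?_⟩
  have := abs_dist_sub_le x y q
  change |(dist x q - dist e q) - (dist y q - dist e q)| ≤ _
  simpa using this

/-! ### Peaking functions and the functionals that norm them -/

/-- On a compact set all of whose points are separated from `a` by functions peaking at `a`, a
single function does so uniformly. -/
theorem exists_peak_of_isCompact (a : OffDiag X) {K : Set (StoneCech (OffDiag X))}
    (hK : IsCompact K)
    (h : ∀ ζ ∈ K, ∃ f : Lip0 X e, Phi f a = ‖f‖ ∧ |PhiBeta f ζ| < ‖f‖) :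
    ∃ F : Lip0 X e, Phi F a = ‖F‖ ∧
      ∃ δ > 0, ∀ z, stoneCechUnit z ∈ K → |Phi F z| ≤ ‖F‖ - δ := by
  let P : Set (StoneCech (OffDiag X)) → Prop := fun s => ∃ F : Lip0 X e, Phi F a = ‖F‖ ∧
    ∃ δ > 0, ∀ z, stoneCechUnit z ∈ s → |Phi F z| ≤ ‖F‖ - δ
  refine hK.induction_on (p := P) ?_ ?_ ?_ ?_
  · refine ⟨0, ?_, 1, one_pos, fun z hz => hz.elim⟩
    have := abs_Phi_le (0 : Lip0 X e) a
    rw [norm_zero] at this ⊢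
    exact abs_nonpos_iff.1 this
  · rintro s t hst ⟨F, hF, δ, hδ, h⟩
    exact ⟨F, hF, δ, hδ, fun z hz => h z (hst hz)⟩
  -- Norms of functions peaking at the same pair add, so `F + G` peaks there and inherits the gap of
  -- either summand.
  · rintro s t ⟨F, hF, δ, hδ, hs⟩ ⟨G, hG, η, hη, ht⟩
    have hle := (le_abs_self _).trans (abs_Phi_le (F + G) a)
    have hadd := norm_add_le F G
    rw [Phi_add, hF, hG] at hle
    refine ⟨F + G, ?_, min δ η, lt_min hδ hη, fun z hz => ?_⟩
    · rw [Phi_add, hF, hG]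
      exact le_antisymm hle hadd
    · rw [Phi_add]
      have h1 := abs_add_le (Phi F z) (Phi G z)
      have h2 := min_le_left δ η
      have h3 := min_le_right δ η
      rcases hz with hz | hz
      · have := hs z hz
        have := abs_Phi_le G z
        linarith
      · have := ht z hz
        have := abs_Phi_le F z
        linarith
  · intro ζ hζ
    obtain ⟨f, hf, hlt⟩ := h ζ hζ
    -- The level `c` turns the strict inequality at `ζ` into a gap `‖f‖ - c` on a whole
    -- neighbourhood.
    obtain ⟨c, hc, hc'⟩ := exists_between hlt
    refine ⟨{ξ | |PhiBeta f ξ| < c}, mem_nhdsWithin_of_mem_nhds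
      ((isOpen_lt (continuous_PhiBeta f).abs continuous_const).mem_nhds hc), f, hf, ‖f‖ - c,
      sub_pos.2 hc', fun z hz => ?_⟩
    have hz' : |PhiBeta f (stoneCechUnit z)| < c := hz
    rw [PhiBeta_stoneCechUnit] at hz'
    linarith

/-- If the pair `(p, q)` is peaking, a functional of norm at most one that attains the norm of every
function peaking at `(p, q)` annihilates all functions with equal values at `p` and `q`. -/
theorem apply_eq_zero_of_peaking {p q : X} (hpq : p ≠ q)
    (hpeak : ∀ ζ : StoneCech (OffDiag X), ζ ≠ pairPt hpq → ζ ≠ pairPt hpq.symm →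
      ∃ f : Lip0 X e, Phi f ⟨(p, q), hpq⟩ = ‖f‖ ∧ |PhiBeta f ζ| < ‖f‖)
    (M : Lip0 X e →ₗ[ℝ] ℝ) (hM : ∀ f, |M f| ≤ ‖f‖)
    (hMpeak : ∀ f : Lip0 X e, Phi f ⟨(p, q), hpq⟩ = ‖f‖ → M f = ‖f‖)
    (f : Lip0 X e) (hf : Phi f ⟨(p, q), hpq⟩ = 0) : M f = 0 := by
  have key : ∀ f : Lip0 X e, Phi f ⟨(p, q), hpq⟩ = 0 → ∀ ε > 0, M f ≤ ε := by
    intro f hf ε hε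
    have hK : IsCompact {ζ | ε ≤ |PhiBeta f ζ|} :=
      (isClosed_le continuous_const (continuous_PhiBeta f).abs).isCompact
    obtain ⟨F, hF, δ, hδ, hFδ⟩ := exists_peak_of_isCompact (e := e) ⟨(p, q), hpq⟩ hK (by
      intro ζ hζ
      have hζ' : ε ≤ |PhiBeta f ζ| := hζ
      refine hpeak ζ ?_ ?_
      · rintro rfl
        rw [pairPt, PhiBeta_stoneCechUnit, hf, abs_zero] at hζ'
        exact absurd hε hζ'.not_gt
      · rintro rfl
        rw [pairPt, PhiBeta_stoneCechUnit, Phi_swap f hpq, hf, neg_zero, abs_zero] at hζ'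
        exact absurd hε hζ'.not_gt)
    -- On the compact set, `t • f` may use up at most the gap `δ`.
    obtain ⟨t, ht, htδ⟩ : ∃ t > 0, t * ‖f‖ ≤ δ := by
      have h0 : 0 < ‖f‖ + 1 := by positivity
      refine ⟨δ / (‖f‖ + 1), by positivity, ?_⟩
      rw [div_mul_eq_mul_div, div_le_iff₀ h0]
      nlinarith
    have hnorm : ‖F + t • f‖ ≤ ‖F‖ + t * ε := by
      refine norm_le_of_abs_Phi_le _ (by positivity) fun z => ?_
      rw [Phi_add, Phi_smul]
      have h1 := abs_add_le (Phi F z) (t * Phi f z)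
      rw [abs_mul, abs_of_pos ht] at h1
      rcases le_or_gt ε |Phi f z| with hz | hz
      · have h2 := hFδ z (by rwa [mem_ofPred_eq, PhiBeta_stoneCechUnit])
        have h3 := mul_le_mul_of_nonneg_left (abs_Phi_le f z) ht.le
        have h4 : 0 ≤ t * ε := by positivity
        linarith
      · have h2 := abs_Phi_le F z
        have h3 := mul_le_mul_of_nonneg_left hz.le ht.le
        linarith
    have h := (le_abs_self _).trans ((hM (F + t • f)).trans hnorm)
    rw [map_add, map_smul, hMpeak F hF, smul_eq_mul] at h
    exact le_of_mul_le_mul_left (by linarith) ht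
  -- The hypothesis on `f` is invariant under negation, so the one-sided bound suffices.
  refine le_antisymm (le_of_forall_gt_imp_ge_of_dense fun ε hε => key f hf ε hε) ?_
  have hneg : Phi (-f) ⟨(p, q), hpq⟩ = 0 := by
    rw [← neg_one_smul ℝ f, Phi_smul, hf, mul_zero]
  have := le_of_forall_gt_imp_ge_of_dense fun ε hε => key (-f) hneg ε hε
  rw [map_neg] at this
  linarith

/-- The distance to `q` has norm one and peaks at `(p, q)`, so `M` is known on it; subtracting a
multiple reduces to the kernel case. -/
theorem apply_eq_Phi_of_peaking {p q : X} (hpq : p ≠ q)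
    (hpeak : ∀ ζ : StoneCech (OffDiag X), ζ ≠ pairPt hpq → ζ ≠ pairPt hpq.symm →
      ∃ f : Lip0 X e, Phi f ⟨(p, q), hpq⟩ = ‖f‖ ∧ |PhiBeta f ζ| < ‖f‖)
    (M : Lip0 X e →ₗ[ℝ] ℝ) (hM : ∀ f, |M f| ≤ ‖f‖)
    (hMpeak : ∀ f : Lip0 X e, Phi f ⟨(p, q), hpq⟩ = ‖f‖ → M f = ‖f‖)
    (f : Lip0 X e) : M f = Phi f ⟨(p, q), hpq⟩ := by
  set c := Phi f ⟨(p, q), hpq⟩ with hc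
  have hd := Phi_distLip0 e hpq
  have hd' : ‖distLip0 e q‖ = 1 := by
    refine le_antisymm (norm_distLip0_le e q) ?_
    rw [← hd]
    exact (le_abs_self _).trans (abs_Phi_le _ _)
  have h := apply_eq_zero_of_peaking hpq hpeak M hM hMpeak (f + (-c) • distLip0 e q) (by
    rw [Phi_add, Phi_smul, hd, ← hc]
    ring)
  rw [map_add, map_smul, hMpeak _ (hd.trans hd'.symm), hd', smul_eq_mul] at h
  linarith

/-! ### Molecules and the dual of the Lipschitz-free space -/

theorem molecule_apply {p q : X} (hpq : p ≠ q) (f : Lip0 X e) :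
    (molecule e p q).1 f = Phi f ⟨(p, q), hpq⟩ := by
  change (dist p q)⁻¹ * (f p - f q) = (f p - f q) / dist p q
  rw [div_eq_inv_mul]

theorem norm_molecule_le {p q : X} (hpq : p ≠ q) : ‖molecule e p q‖ ≤ 1 := by
  refine ContinuousLinearMap.opNorm_le_bound _ zero_le_one fun f => ?_
  rw [one_mul]
  exact (congrArg abs (molecule_apply hpq f)).trans_le (abs_Phi_le f _)

/-- The dual of a normed space, its topology being the one of the norm. -/
abbrev NormedDual (Y : Type*) [NormedAddCommGroup Y] [NormedSpace ℝ Y] : Type _ :=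
  StrongDual ℝ Y

/-- Elements of `Lip₀(X)` act as functionals on the Lipschitz-free space. -/
noncomputable def toDualLipFree (X : Type*) [MetricSpace X] (e : X) :
    Lip0 X e →ₗ[ℝ] NormedDual (LipFree X e) where
  toFun f := (NormedSpace.inclusionInDoubleDual ℝ (Lip0 X e) f).comp (LipFree X e).subtypeL
  map_add' f g := by
    rw [map_add, ContinuousLinearMap.add_comp]
  map_smul' c f := by
    rw [map_smul, ContinuousLinearMap.smul_comp, RingHom.id_apply]

theorem toDualLipFree_apply (f : Lip0 X e) (y : LipFree X e) :
    toDualLipFree X e f y = y.1 f := rfl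

theorem norm_toDualLipFree_le (f : Lip0 X e) : ‖toDualLipFree X e f‖ ≤ ‖f‖ := by
  refine ContinuousLinearMap.opNorm_le_bound _ (norm_nonneg f) fun y => ?_
  rw [toDualLipFree_apply, mul_comm]
  exact y.1.le_opNorm f

theorem norm_j_sub_j_le (e x y : X) : ‖j e x - j e y‖ ≤ dist x y := by
  refine ContinuousLinearMap.opNorm_le_bound _ dist_nonneg fun f => ?_
  rw [mul_comm]
  exact (Lip0.isLipConst_norm f).2 x y

theorem j_basePoint (e : X) : j e e = 0 :=
  Subtype.ext (ContinuousLinearMap.ext fun f => f.2.2)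

/-- Two functionals on the Lipschitz-free space agreeing on `j(X)` are equal. -/
theorem dualLipFree_ext {φ ψ : NormedDual (LipFree X e)} (h : ∀ x, φ (j e x) = ψ (j e x)) :
    φ = ψ := by
  have hspan : ∀ y (hy : y ∈ Submodule.span ℝ (range (evalDual e))),
      φ ⟨y, Submodule.le_topologicalClosure _ hy⟩ =
        ψ ⟨y, Submodule.le_topologicalClosure _ hy⟩ := by
    intro y hy
    induction hy using Submodule.span_induction with
    | mem y hy =>
      obtain ⟨x, rfl⟩ := hy
      exact h x
    | zero => exact (map_zero φ).trans (map_zero ψ).symm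
    | add y z hy hz ihy ihz =>
      have hy' := Submodule.le_topologicalClosure _ hy
      have hz' := Submodule.le_topologicalClosure _ hz
      exact (map_add φ ⟨y, hy'⟩ ⟨z, hz'⟩).trans
        ((congrArg₂ (· + ·) ihy ihz).trans (map_add ψ ⟨y, hy'⟩ ⟨z, hz'⟩).symm)
    | smul c y hy ihy =>
      have hy' := Submodule.le_topologicalClosure _ hy
      exact (map_smul φ c ⟨y, hy'⟩).trans
        ((congrArg (c • ·) ihy).trans (map_smul ψ c ⟨y, hy'⟩).symm)
  have hdense : Dense {y : LipFree X e | y.1 ∈ Submodule.span ℝ (range (evalDual e))} := by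
    intro y
    rw [closure_subtype]
    refine closure_mono ?_ y.2
    intro z hz
    exact ⟨⟨z, Submodule.le_topologicalClosure _ hz⟩, hz, rfl⟩
  exact ContinuousLinearMap.ext fun y =>
    congrFun (Continuous.ext_on hdense φ.continuous ψ.continuous fun y hy => hspan y.1 hy) y

/-- A functional composed with `j` is Lipschitz because `j` is 1-Lipschitz, vanishes at `e`, and
recovers the functional by density of the span. -/
theorem toDualLipFree_surjective : Function.Surjective (toDualLipFree X e) := by
  intro φ
  refine ⟨⟨fun x => φ (j e x), ⟨‖φ‖, norm_nonneg φ, fun x y => ?_⟩, ?_⟩,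
    dualLipFree_ext fun x => rfl⟩
  · rw [← map_sub]
    exact (φ.le_opNorm _).trans (mul_le_mul_of_nonneg_left (norm_j_sub_j_le e x y) (norm_nonneg φ))
  · change φ (j e e) = 0
    rw [j_basePoint, map_zero]

end

/-! ### Extremality in the bidual -/

theorem mem_closedBall_bidual_iff {Y : Type*} [NormedAddCommGroup Y] [NormedSpace ℝ Y]
    {m : StrongDual ℝ (StrongDual ℝ Y)} :
    m ∈ Metric.closedBall (0 : StrongDual ℝ (StrongDual ℝ Y)) 1 ↔ ‖m‖ ≤ 1 :=
  mem_closedBall_zero_iff (E := StrongDual ℝ (StrongDual ℝ Y))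

/-- A vector whose canonical image is extreme in the bidual ball is a preserved
extreme point. -/
theorem isPreservedExtremePoint_of_bidual {Y : Type*} [NormedAddCommGroup Y] [NormedSpace ℝ Y]
    {x : Y} (h : NormedSpace.inclusionInDoubleDual ℝ Y x ∈
      extremePoints ℝ (Metric.closedBall (0 : StrongDual ℝ (StrongDual ℝ Y)) 1)) :
    IsPreservedExtremePoint x := by
  refine ⟨?_, h⟩
  have hnorm : ∀ y : Y, ‖NormedSpace.inclusionInDoubleDual ℝ Y y‖ = ‖y‖ :=
    (NormedSpace.inclusionInDoubleDualLi (E := Y) ℝ).norm_map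
  rw [mem_extremePoints_iff_left] at h ⊢
  refine ⟨mem_closedBall_zero_iff.2 ((hnorm x).symm.trans_le (mem_closedBall_bidual_iff.1 h.1)), ?_⟩
  rintro y hy z hz ⟨a, b, ha, hb, hab, rfl⟩
  -- The canonical embedding is a linear isometry, so a splitting in `Y` maps to one in the bidual
  -- ball.
  refine (NormedSpace.inclusionInDoubleDualLi (E := Y) ℝ).injective
    (h.2 _ (mem_closedBall_bidual_iff.2 ((hnorm y).trans_le (mem_closedBall_zero_iff.1 hy)))
      _ (mem_closedBall_bidual_iff.2 ((hnorm z).trans_le (mem_closedBall_zero_iff.1 hz)))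
      ⟨a, b, ha, hb, hab, ?_⟩)
  rw [map_add, map_smul, map_smul]
  rfl

/-- The canonical image of the molecule of a peaking pair is extreme in the bidual ball. -/
theorem inclusion_molecule_mem_extremePoints {X : Type*} [MetricSpace X] {e p q : X} (hpq : p ≠ q)
    (hpeak : ∀ ζ : StoneCech (OffDiag X), ζ ≠ pairPt hpq → ζ ≠ pairPt hpq.symm →
      ∃ f : Lip0 X e, Phi f ⟨(p, q), hpq⟩ = ‖f‖ ∧ |PhiBeta f ζ| < ‖f‖) :
    NormedSpace.inclusionInDoubleDual ℝ (LipFree X e) (molecule e p q) ∈ Set.extremePoints ℝ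
      (Metric.closedBall (0 : NormedDual (NormedDual (LipFree X e))) 1) := by
  rw [mem_extremePoints_iff_left]
  refine ⟨mem_closedBall_bidual_iff.2
    ((NormedSpace.double_dual_bound ℝ _ _).trans (norm_molecule_le hpq)), ?_⟩
  rintro m hm n hn ⟨a, b, ha, hb, hab, hmn⟩
  replace hm := mem_closedBall_bidual_iff.1 hm
  replace hn := mem_closedBall_bidual_iff.1 hn
  have hbound : ∀ m : NormedDual (NormedDual (LipFree X e)), ‖m‖ ≤ 1 →
      ∀ f : Lip0 X e, |m (toDualLipFree X e f)| ≤ ‖f‖ := fun m hm f =>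
    (m.le_of_opNorm_le hm _).trans ((one_mul _).trans_le (norm_toDualLipFree_le f))
  have heval : ∀ f : Lip0 X e, a * m (toDualLipFree X e f) + b * n (toDualLipFree X e f) =
      Phi f ⟨(p, q), hpq⟩ := fun f =>
    (DFunLike.congr_fun hmn (toDualLipFree X e f)).trans (molecule_apply hpq f)
  -- At a peaking `f`, the average of two values at most `‖f‖` equals `‖f‖`; as `a > 0`, the value
  -- of `m` is `‖f‖`.
  have hMf := apply_eq_Phi_of_peaking hpq hpeak (m.toLinearMap.comp (toDualLipFree X e))
    (hbound m hm) (by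
      intro f hf
      change m (toDualLipFree X e f) = ‖f‖
      have h1 := (le_abs_self _).trans (hbound m hm f)
      have h2 := (le_abs_self _).trans (hbound n hn f)
      have h3 := heval f
      rw [hf] at h3
      have h4 := mul_le_mul_of_nonneg_left h2 hb.le
      refine le_antisymm h1 (le_of_mul_le_mul_left ?_ ha)
      have h5 : a * ‖f‖ + b * ‖f‖ = ‖f‖ := by rw [← add_mul, hab, one_mul]
      linarith)
  refine ContinuousLinearMap.ext fun φ => ?_
  obtain ⟨f, rfl⟩ := toDualLipFree_surjective φ
  exact (hMf f).trans (molecule_apply hpq f).symm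

end LipschitzFree

theorem proposition3p4 {X : Type*} [MetricSpace X] (e p q : X) (hpq : p ≠ q)
    (hpeak : ∀ ζ : StoneCech (LipschitzFree.OffDiag X),
      ζ ≠ LipschitzFree.pairPt hpq → ζ ≠ LipschitzFree.pairPt hpq.symm →
        ∃ f : LipschitzFree.Lip0 X e,
          LipschitzFree.Phi f ⟨(p, q), hpq⟩ = LipschitzFree.lipNum f ∧
            |LipschitzFree.PhiBeta f ζ| < LipschitzFree.lipNum f) :
    LipschitzFree.IsPreservedExtremePoint (LipschitzFree.molecule e p q) := 
  LipschitzFree.isPreservedExtremePoint_of_bidual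
    (LipschitzFree.inclusion_molecule_mem_extremePoints hpq fun ζ h₁ h₂ => hpeak ζ h₁ h₂)
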